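/- Let $d\ge 1$ and let $\mathbb B_d$ be the open unit ball of $\mathbb C^d$. For $f$ holomorphic on $\mathbb B_d$ put $$|||f||| = \sup_{\zeta\in\partial\mathbb B_d}\ \sup_{0<r<1}\int_0^{2\pi}\log\bigl(1+|f(re^{i\theta}\zeta)|\bigr)\frac{d\theta}{2\pi}\in[0,\infty],\qquad \rho(f,h)=|||f-h|||,\qquad f_r(z)=f(rz),$$ let $N_u$ be the set of holomorphic $f$ on $\mathbb B_d$ with $|||f|||<\infty$, and let $N_u^+=\{f\in N_u:\ \lim_{r\uparrow1}\rho(f_r,f)=0\}$, with the metric $\rho$. A normed space of functions on $\mathbb B_d$ is called continuously contained in $N_u^+$ if it is a subset of $N_u^+$ and the inclusion map is continuous from the norm to $\rho$. Theorem. Let $X$ be a Banach space of holomorphic functions on $\mathbb B_d$ (that is, a linear space of holomorphic functions on $\mathbb B_d$ with pointwise operations, with a complete norm). Let $\mathrm{Mult}(X)=\{\varphi:\mathbb B_d\to\mathbb C:\ \varphi f\in X\text{ for all }f\in X\}$. Assume that $X$ contains the constants (so that $\mathrm{Mult}(X)\subset X$), that $\mathrm{Mult}(X)$ is dense in $X$,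 and that $X$ is continuously contained in $N_u^+$. Let $g\in X$ be cyclic, that is, $\{\varphi g:\varphi\in\mathrm{Mult}(X)\}$ is dense in $X$. Then $g$ has no zeros in $\mathbb B_d$, and the space $\frac1g X=\{f/g: f\in X\}$, with the norm $\|f/g\|_{\frac1gX}=\|f\|_X$, is continuously contained in $N_u^+$. -/

import Mathlib

open Set Filter Topology Metric
open scoped ENNReal

noncomputable section

namespace UniformSmirnov

/-- The space `ℂ^d` with its Euclidean norm. -/
abbrev Cd (d : ℕ) : Type := EuclideanSpace ℂ (Fin d)

/-- The open unit ball `𝔹_d` of `ℂ^d`. A function on the ball is represented by a function on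
`ℂ^d` whose values off the ball are irrelevant. -/
abbrev unitBall (d : ℕ) : Set (Cd d) := ball (0 : Cd d) 1

/-- `f` is holomorphic on `𝔹_d`. -/
def IsHol {d : ℕ} (f : Cd d → ℂ) : Prop := DifferentiableOn ℂ f (unitBall d)

/-- The quantity `|||f|||`: the supremum over `ζ ∈ ∂𝔹_d` and `0 < r < 1` of the mean of
`log (1 + |f (r e^{iθ} ζ)|)` over the circle with respect to `dθ / 2π`, as an element of `[0, ∞]`. For `f`
holomorphic on the ball the integrand is continuous in `θ`. -/
def logSize {d : ℕ} (f : Cd d → ℂ) : ℝ≥0∞ :=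
  ⨆ ζ ∈ sphere (0 : Cd d) 1, ⨆ r ∈ Ioo (0 : ℝ) 1,
    ENNReal.ofReal (Real.circleAverage (fun w : ℂ => Real.log (1 + ‖f (w • ζ)‖)) 0 r)

/-- The metric `ρ(f, g) = |||f - g|||`. -/
def rho {d : ℕ} (f g : Cd d → ℂ) : ℝ≥0∞ := logSize (fun z => f z - g z)

/-- The dilation `f_r(z) = f(rz)`. -/
def dilate {d : ℕ} (r : ℝ) (f : Cd d → ℂ) : Cd d → ℂ := fun z => f ((r : ℂ) • z)

/-- `N_u`: the holomorphic functions on the ball with `|||f||| < ∞`. -/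
def Nu (d : ℕ) : Set (Cd d → ℂ) := {f | IsHol f ∧ logSize f < ∞}

/-- The uniform Smirnov class `N_u^+`: those `f ∈ N_u` with `ρ(f_r, f) → 0` as `r ↑ 1`. -/
def NuPlus (d : ℕ) : Set (Cd d → ℂ) :=
  {f | f ∈ Nu d ∧ Tendsto (fun r : ℝ => rho (dilate r f) f) (𝓝[<] 1) (𝓝 0)}

section Spaces

variable {d : ℕ} {X : Type*} [NormedAddCommGroup X] [NormedSpace ℂ X]

/-- `X` is, through the linear map `J`, a normed space of holomorphic functions on the ball: every
`J x` is holomorphic on the ball, and `x` is determined by the restriction of `J x` to the ball. -/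
structure IsHolSpace (J : X →ₗ[ℂ] (Cd d → ℂ)) : Prop where
  hol : ∀ x, IsHol (J x)
  inj : ∀ x y, EqOn (J x) (J y) (unitBall d) → x = y

/-- The function `f` on the ball belongs to the function space `X`. -/
def MemSpace (J : X →ₗ[ℂ] (Cd d → ℂ)) (f : Cd d → ℂ) : Prop :=
  ∃ x, EqOn (J x) f (unitBall d)

/-- `φ ∈ Mult(X)`: `φ f ∈ X` for all `f ∈ X`. -/
def IsMult (J : X →ₗ[ℂ] (Cd d → ℂ)) (φ : Cd d → ℂ) : Prop :=
  ∀ x, MemSpace J (fun z => φ z * J x z)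

/-- `Mult(X)`, as a set of elements of `X`, is dense in `X`. -/
def MultDense (J : X →ₗ[ℂ] (Cd d → ℂ)) : Prop :=
  Dense {x : X | ∃ φ, IsMult J φ ∧ EqOn (J x) φ (unitBall d)}

/-- `g ∈ X` is cyclic: `{φ g : φ ∈ Mult(X)}` is dense in `X`. -/
def IsCyclicElem (J : X →ₗ[ℂ] (Cd d → ℂ)) (g : X) : Prop :=
  Dense {x : X | ∃ φ, IsMult J φ ∧ EqOn (J x) (fun z => φ z * J g z) (unitBall d)}

/-- The normed space of functions given by `J` is contained in `N_u^+`, and the inclusion is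
continuous from the norm of `X` to the metric `ρ`. -/
def ContinuouslyContained (J : X →ₗ[ℂ] (Cd d → ℂ)) : Prop :=
  (∀ x, J x ∈ NuPlus d) ∧ ∀ x, Tendsto (fun y => rho (J y) (J x)) (𝓝 x) (𝓝 0)

/-- The space `(1/g) X` of all quotients `f / g`, `f ∈ X`, with the norm `‖f / g‖ = ‖f‖_X`: the
normed space `X` itself, with `x` realized as the function `J x / g`. -/
def invSpace (g : Cd d → ℂ) (J : X →ₗ[ℂ] (Cd d → ℂ)) : X →ₗ[ℂ] (Cd d → ℂ) where
  toFun x := fun z => J x z / g z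
  map_add' x y := by
    funext z
    simp [add_div]
  map_smul' c x := by
    funext z
    simp [mul_div_assoc]

end Spaces

end UniformSmirnov

end

/-! Everything reduces to showing `1/g ∈ N_u^+`. By cyclicity and continuous containment some
multiplier `φ` makes `φg` ρ-close to `1`. For any other multiplier `ψ`, off the zeros of `φg`, `ψ -
1/g = (ψg - 1) φ / (φg)`. The factor `1/(φg)` is harmless: `log|φg|` is subharmonic, so its circle
means are at least `log|φ(0)g(0)|`, which is nearly `≥ 0`. The factor `φ` is a bounded dilation plus
a ρ-small error, so multiplying by it costs a fixed multiple of `|||ψg - 1|||`. Hence multipliers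
approximate `1/g` (`exists_rho_inv_le`), and `N_u^+` is ρ-closed
(`mem_NuPlus_of_forall_exists_rho_le`). Multiplication by an element of `N_u^+` is ρ-continuous at
`0` (`exists_logSize_mul_le`). Applied to `f`, this makes `f/g` a limit of functions `ψf ∈ X`;
applied to `1/g`, it makes the inclusion of `(1/g)X` continuous. -/

namespace UniformSmirnov

/-! ### Jensen's formula on the disc -/

/-- The part of Jensen's formula that bounds the value at the centre. -/
lemma log_norm_le_circleAverage {f : ℂ → ℂ} {r : ℝ} (hr : r ∈ Ioo (0 : ℝ) 1)
    (hf : DifferentiableOn ℂ f (ball 0 1)) (h0 : f 0 ≠ 0) :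
    Real.log ‖f 0‖ ≤ Real.circleAverage (fun w => Real.log ‖f w‖) 0 r := by
  have han : AnalyticOnNhd ℂ f (closedBall 0 |r|) :=
    (hf.analyticOnNhd isOpen_ball).mono
      (closedBall_subset_ball (by rw [abs_of_pos hr.1]; exact hr.2))
  rw [han.circleAverage_log_norm hr.1.ne' h0]
  refine le_add_of_nonneg_left (finsum_nonneg fun u => ?_)
  by_cases hu : u ∈ closedBall (0 : ℂ) |r|
  · refine mul_nonneg (by exact_mod_cast MeromorphicOn.AnalyticOnNhd.divisor_nonneg han u) ?_
    rcases eq_or_ne u 0 with rfl | hu0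
    · simp
    · apply Real.log_nonneg
      rw [mem_closedBall_zero_iff, abs_of_pos hr.1] at hu
      rw [zero_sub, norm_neg, ← div_eq_mul_inv, one_le_div (norm_pos_iff.2 hu0)]
      exact hu
  · simp [hu]

/-- A holomorphic function on the disc which does not vanish at the centre is nonzero at all but
discretely many points of a circle. -/
lemma eventually_codiscreteWithin_sphere_ne_zero {f : ℂ → ℂ} {r : ℝ} (hr : r ∈ Ioo (0 : ℝ) 1)
    (hf : DifferentiableOn ℂ f (ball 0 1)) (h0 : f 0 ≠ 0) :
    ∀ᶠ w in codiscreteWithin (sphere (0 : ℂ) |r|), f w ≠ 0 := by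
  have hsub : sphere (0 : ℂ) |r| ⊆ ball 0 1 :=
    sphere_subset_ball (by rw [abs_of_pos hr.1]; exact hr.2)
  refine Filter.codiscreteWithin_mono hsub
    (((hf.analyticOnNhd isOpen_ball).eqOn_zero_or_eventually_ne_zero_of_preconnected
      (convex_ball 0 1).isPreconnected).resolve_left fun h => h0 (h (mem_ball_self one_pos)))

/-- The part of Jensen's formula that accounts for one zero. -/
lemma log_norm_add_log_le_circleAverage {f : ℂ → ℂ} {r : ℝ} (hr : r ∈ Ioo (0 : ℝ) 1)
    (hf : DifferentiableOn ℂ f (ball 0 1)) (h0 : f 0 ≠ 0) {a : ℂ} (ha : ‖a‖ ≤ r)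
    (hfa : f a = 0) :
    Real.log ‖f 0‖ + Real.log (r / ‖a‖) ≤ Real.circleAverage (fun w => Real.log ‖f w‖) 0 r := by
  have ha0 : a ≠ 0 := fun h => h0 (h ▸ hfa)
  have hapos := norm_pos_iff.2 ha0
  -- Divide out the zero: `f = (w - a) · dslope f a`. The mean of `log|w - a|` is `log r`, not
  -- `log|a|`, which is the gain over the centre value.
  have hd : DifferentiableOn ℂ (dslope f a) (ball 0 1) :=
    (Complex.differentiableOn_dslope
      (isOpen_ball.mem_nhds (mem_ball_zero_iff.2 (ha.trans_lt hr.2)))).2 hf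
  have hfac : ∀ w, f w = (w - a) * dslope f a w := fun w => by
    have := sub_smul_dslope f a w
    rw [smul_eq_mul, hfa, sub_zero] at this
    exact this.symm
  have hd0 : dslope f a 0 ≠ 0 := fun h => h0 (by rw [hfac, h, mul_zero])
  have hsub : sphere (0 : ℂ) |r| ⊆ ball 0 1 :=
    sphere_subset_ball (by rw [abs_of_pos hr.1]; exact hr.2)
  have hand := hd.analyticOnNhd isOpen_ball
  have hI1 : CircleIntegrable (fun w => Real.log ‖w - a‖) 0 r :=
    circleIntegrable_log_norm_sub_const r
  have hI2 : CircleIntegrable (fun w => Real.log ‖dslope f a w‖) 0 r :=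
    MeromorphicOn.circleIntegrable_log_norm (hand.mono hsub).meromorphicOn
  have h1 := log_norm_le_circleAverage hr hd hd0
  have heq : Real.circleAverage (fun w => Real.log ‖f w‖) 0 r
      = Real.circleAverage (fun w => Real.log ‖w - a‖ + Real.log ‖dslope f a w‖) 0 r := by
    refine Real.circleAverage_congr_codiscreteWithin ?_ hr.1.ne'
    filter_upwards [eventually_codiscreteWithin_sphere_ne_zero hr hf h0] with w hw
    rw [hfac w] at hw ⊢
    rw [norm_mul, Real.log_mul (norm_ne_zero_iff.2 (left_ne_zero_of_mul hw))
      (norm_ne_zero_iff.2 (right_ne_zero_of_mul hw))]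
  have hav : Real.circleAverage (fun w => Real.log ‖w - a‖) 0 r = Real.log r :=
    circleAverage_log_norm_sub_const_of_mem_closedBall
      (by rw [mem_closedBall_zero_iff, abs_of_pos hr.1]; exact ha)
  rw [heq, Real.circleAverage_fun_add hI1 hI2, hav, hfac 0, zero_sub, norm_mul, norm_neg,
    Real.log_mul hapos.ne' (norm_ne_zero_iff.2 hd0), Real.log_div hr.1.ne' hapos.ne']
  linarith

end UniformSmirnov
namespace UniformSmirnov

/-! ### Slices and basic bounds for `|||f|||` -/

variable {d : ℕ}

lemma smul_mem_unitBall {ζ : Cd d} (hζ : ζ ∈ sphere (0 : Cd d) 1) {w : ℂ}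
    (hw : w ∈ ball (0 : ℂ) 1) : w • ζ ∈ unitBall d := by
  rw [mem_sphere_zero_iff_norm] at hζ
  rw [mem_ball_zero_iff] at hw ⊢
  rwa [norm_smul, hζ, mul_one]

lemma sphere_abs_subset_ball {r : ℝ} (hr : r ∈ Ioo (0 : ℝ) 1) :
    sphere (0 : ℂ) |r| ⊆ ball 0 1 :=
  sphere_subset_ball (by rw [abs_of_pos hr.1]; exact hr.2)

/-- Slices of holomorphic functions are holomorphic on the disc. -/
lemma IsHol.slice {f : Cd d → ℂ} (hf : IsHol f) {ζ : Cd d} (hζ : ζ ∈ sphere (0 : Cd d) 1) :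
    DifferentiableOn ℂ (fun w : ℂ => f (w • ζ)) (ball 0 1) :=
  DifferentiableOn.comp (t := unitBall d) hf (f := fun w : ℂ => w • ζ) (by fun_prop)
    fun _ hw => smul_mem_unitBall hζ hw

lemma IsHol.circleIntegrable_log {f : Cd d → ℂ} (hf : IsHol f) {ζ : Cd d}
    (hζ : ζ ∈ sphere (0 : Cd d) 1) {r : ℝ} (hr : r ∈ Ioo (0 : ℝ) 1) :
    CircleIntegrable (fun w : ℂ => Real.log (1 + ‖f (w • ζ)‖)) 0 r := by
  refine ContinuousOn.circleIntegrable' (ContinuousOn.log ?_ fun w _ => by positivity)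
  exact continuousOn_const.add
    ((hf.slice hζ).continuousOn.mono (sphere_abs_subset_ball hr)).norm

lemma le_logSize (f : Cd d → ℂ) {ζ : Cd d} (hζ : ζ ∈ sphere (0 : Cd d) 1) {r : ℝ}
    (hr : r ∈ Ioo (0 : ℝ) 1) :
    ENNReal.ofReal (Real.circleAverage (fun w : ℂ => Real.log (1 + ‖f (w • ζ)‖)) 0 r)
      ≤ logSize f := by
  unfold logSize
  exact le_iSup₂_of_le ζ hζ (le_iSup₂_of_le r hr le_rfl)

lemma logSize_le {f : Cd d → ℂ} {C : ℝ≥0∞}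
    (h : ∀ ζ ∈ sphere (0 : Cd d) 1, ∀ r ∈ Ioo (0 : ℝ) 1,
      ENNReal.ofReal (Real.circleAverage (fun w : ℂ => Real.log (1 + ‖f (w • ζ)‖)) 0 r) ≤ C) :
    logSize f ≤ C :=
  iSup₂_le fun ζ hζ => iSup₂_le fun r hr => h ζ hζ r hr

lemma logSize_congr {f h : Cd d → ℂ} (hfh : EqOn f h (unitBall d)) : logSize f = logSize h := by
  have key : ∀ {f h : Cd d → ℂ}, EqOn f h (unitBall d) → logSize f ≤ logSize h := by
    intro f h hfh
    refine logSize_le fun ζ hζ r hr => (le_of_eq ?_).trans (le_logSize h hζ hr)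
    congr 1
    refine Real.circleAverage_congr_sphere fun w hw => ?_
    simp only [hfh (smul_mem_unitBall hζ (sphere_abs_subset_ball hr hw))]
  exact le_antisymm (key hfh) (key hfh.symm)

lemma rho_congr {f₁ f₂ h₁ h₂ : Cd d → ℂ} (hf : EqOn f₁ f₂ (unitBall d))
    (hh : EqOn h₁ h₂ (unitBall d)) : rho f₁ h₁ = rho f₂ h₂ :=
  logSize_congr fun z hz => by simp only [hf hz, hh hz]

/-- The basic comparison principle: a bound off the zeros of `H` for `1 + |f|` by a product that
involves `1 / |H|` gives a bound for `|||f|||`, since `log |H|` is subharmonic. -/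
lemma logSize_le_of_le_div {f k D H : Cd d → ℂ} (hf : IsHol f) (hk : IsHol k) (hD : IsHol D)
    (hH : IsHol H) (N : ℕ) (hH0 : H 0 ≠ 0)
    (hle : ∀ z ∈ unitBall d, H z ≠ 0 →
      1 + ‖f z‖ ≤ (1 + ‖k z‖) ^ N * (1 + ‖D z‖) * (1 + ‖H z - 1‖) / ‖H z‖) :
    logSize f ≤ N * logSize k + logSize D + logSize (fun z => H z - 1)
      + ENNReal.ofReal (-Real.log ‖H 0‖) := by
  refine logSize_le fun ζ hζ r hr => ?_
  have hH1 : IsHol (fun z => H z - 1) := DifferentiableOn.sub_const hH 1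
  have hHs := hH.slice hζ
  have hHs0 : H ((0 : ℂ) • ζ) ≠ 0 := by rwa [zero_smul]
  have If := hf.circleIntegrable_log hζ hr
  have Ik := hk.circleIntegrable_log hζ hr
  have ID := hD.circleIntegrable_log hζ hr
  have I1 := hH1.circleIntegrable_log hζ hr
  have IH : CircleIntegrable (fun w : ℂ => Real.log ‖H (w • ζ)‖) 0 r :=
    MeromorphicOn.circleIntegrable_log_norm
      ((hHs.analyticOnNhd isOpen_ball).mono (sphere_abs_subset_ball hr)).meromorphicOn
  have Ink : CircleIntegrable (fun w : ℂ => (N : ℝ) • Real.log (1 + ‖k (w • ζ)‖)) 0 r :=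
    Ik.const_fun_smul
  have hcd := eventually_codiscreteWithin_sphere_ne_zero hr hHs hHs0
  set R : ℂ → ℝ := fun w => (N : ℝ) • Real.log (1 + ‖k (w • ζ)‖) + Real.log (1 + ‖D (w • ζ)‖)
    + Real.log (1 + ‖H (w • ζ) - 1‖) - Real.log ‖H (w • ζ)‖ with hR
  have IR : CircleIntegrable R 0 r := (((Ink.fun_add ID).fun_add I1).fun_sub IH)
  classical
  -- At zeros of `H` the default `Real.log 0 = 0` makes `R` useless as a bound. Changing `R` on this
  -- discrete set keeps its mean and makes the inequality hold at every point of the circle.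
  set R' : ℂ → ℝ := fun w => if H (w • ζ) = 0 then Real.log (1 + ‖f (w • ζ)‖) else R w with hR'
  have hRR' : R =ᶠ[codiscreteWithin (sphere (0 : ℂ) |r|)] R' := by
    filter_upwards [hcd] with w hw
    simp only [hR', if_neg hw]
  have Iab := Ink.fun_add ID
  have Iabc := Iab.fun_add I1
  have havg : Real.circleAverage R 0 r
      = N * Real.circleAverage (fun w : ℂ => Real.log (1 + ‖k (w • ζ)‖)) 0 r
        + Real.circleAverage (fun w : ℂ => Real.log (1 + ‖D (w • ζ)‖)) 0 r
        + Real.circleAverage (fun w : ℂ => Real.log (1 + ‖H (w • ζ) - 1‖)) 0 r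
        - Real.circleAverage (fun w : ℂ => Real.log ‖H (w • ζ)‖) 0 r := by
    rw [hR, Real.circleAverage_fun_sub Iabc IH,
      Real.circleAverage_fun_add Iab I1, Real.circleAverage_fun_add Ink ID,
      Real.circleAverage_fun_smul, smul_eq_mul]
  have hmono : Real.circleAverage (fun w : ℂ => Real.log (1 + ‖f (w • ζ)‖)) 0 r
      ≤ Real.circleAverage R 0 r := by
    rw [Real.circleAverage_congr_codiscreteWithin hRR' hr.1.ne']
    refine Real.circleAverage_mono If (IR.congr_codiscreteWithin hRR') fun w hw => ?_
    by_cases hw0 : H (w • ζ) = 0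
    · simp only [hR', if_pos hw0, le_refl]
    · simp only [hR', if_neg hw0, hR]
      have hn : (0 : ℝ) < ‖H (w • ζ)‖ := norm_pos_iff.2 hw0
      have := Real.log_le_log (by positivity)
        (hle _ (smul_mem_unitBall hζ (sphere_abs_subset_ball hr hw)) hw0)
      rwa [Real.log_div (by positivity) hn.ne', Real.log_mul (by positivity) (by positivity),
        Real.log_mul (by positivity) (by positivity), Real.log_pow] at this
  have hJ := log_norm_le_circleAverage hr hHs hHs0
  simp only [zero_smul] at hJ
  calc ENNReal.ofReal (Real.circleAverage (fun w : ℂ => Real.log (1 + ‖f (w • ζ)‖)) 0 r)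
      ≤ ENNReal.ofReal (N * Real.circleAverage (fun w : ℂ => Real.log (1 + ‖k (w • ζ)‖)) 0 r
        + Real.circleAverage (fun w : ℂ => Real.log (1 + ‖D (w • ζ)‖)) 0 r
        + Real.circleAverage (fun w : ℂ => Real.log (1 + ‖H (w • ζ) - 1‖)) 0 r
        + (-Real.log ‖H 0‖)) := ENNReal.ofReal_le_ofReal (by linarith)
    _ ≤ N * ENNReal.ofReal (Real.circleAverage (fun w : ℂ => Real.log (1 + ‖k (w • ζ)‖)) 0 r)
        + ENNReal.ofReal (Real.circleAverage (fun w : ℂ => Real.log (1 + ‖D (w • ζ)‖)) 0 r)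
        + ENNReal.ofReal (Real.circleAverage (fun w : ℂ => Real.log (1 + ‖H (w • ζ) - 1‖)) 0 r)
        + ENNReal.ofReal (-Real.log ‖H 0‖) := by
      refine ENNReal.ofReal_add_le.trans (add_le_add_left ?_ _)
      refine ENNReal.ofReal_add_le.trans (add_le_add_left ?_ _)
      refine ENNReal.ofReal_add_le.trans (add_le_add_left ?_ _)
      rw [ENNReal.ofReal_mul (by positivity), ENNReal.ofReal_natCast]
    _ ≤ _ := by
      gcongr
      · exact le_logSize k hζ hr
      · exact le_logSize D hζ hr
      · exact le_logSize (fun z => H z - 1) hζ hr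

lemma logSize_zero : logSize (fun _ : Cd d => (0 : ℂ)) = 0 := by
  refine le_antisymm (logSize_le fun ζ _ r _ => ?_) zero_le
  simp [Real.circleAverage_const]

lemma logSize_le_of_le {f k D : Cd d → ℂ} (hf : IsHol f) (hk : IsHol k) (hD : IsHol D) (N : ℕ)
    (hle : ∀ z ∈ unitBall d, 1 + ‖f z‖ ≤ (1 + ‖k z‖) ^ N * (1 + ‖D z‖)) :
    logSize f ≤ N * logSize k + logSize D := by
  have h := logSize_le_of_le_div (H := fun _ => 1) hf hk hD (differentiableOn_const _) N
    one_ne_zero (fun z hz _ => by simpa using hle z hz)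
  simpa [logSize_zero] using h

lemma logSize_add_le {f h : Cd d → ℂ} (hf : IsHol f) (hh : IsHol h) :
    logSize (fun z => f z + h z) ≤ logSize f + logSize h := by
  have := logSize_le_of_le (DifferentiableOn.fun_add hf hh) hf hh 1 fun z _ => by
    nlinarith [norm_add_le (f z) (h z), norm_nonneg (f z), norm_nonneg (h z)]
  simpa using this

lemma rho_comm (f h : Cd d → ℂ) : rho f h = rho h f := by
  unfold rho logSize
  simp only [norm_sub_rev]

lemma rho_triangle {f h k : Cd d → ℂ} (hf : IsHol f) (hh : IsHol h) (hk : IsHol k) :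
    rho f k ≤ rho f h + rho h k := by
  have := logSize_add_le (DifferentiableOn.fun_sub hf hh) (DifferentiableOn.fun_sub hh hk)
  simpa only [sub_add_sub_cancel, rho] using this

/-! ### Dilations, closedness of `N_u^+`, and multiplication -/

lemma logSize_dilate_le {f : Cd d → ℂ} {s : ℝ} (hs : s ∈ Ioo (0 : ℝ) 1) :
    logSize (dilate s f) ≤ logSize f := by
  refine logSize_le fun ζ hζ r hr => ?_
  have hsr : s * r ∈ Ioo (0 : ℝ) 1 :=
    ⟨mul_pos hs.1 hr.1, mul_lt_one_of_nonneg_of_lt_one_left hs.1.le hs.2 hr.2.le⟩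
  refine (le_of_eq ?_).trans (le_logSize f hζ hsr)
  rw [Real.circleAverage_eq_circleAverage_zero_one (R := r),
    Real.circleAverage_eq_circleAverage_zero_one (R := s * r)]
  simp [dilate, smul_smul, mul_assoc]

lemma IsHol.dilate {f : Cd d → ℂ} (hf : IsHol f) {s : ℝ} (hs : s ∈ Ioo (0 : ℝ) 1) :
    IsHol (dilate s f) := by
  refine DifferentiableOn.comp (t := unitBall d) hf (f := fun z : Cd d => (s : ℂ) • z)
    (by fun_prop) fun z hz => ?_
  rw [mem_ball_zero_iff] at hz ⊢
  rw [norm_smul, Complex.norm_real, Real.norm_of_nonneg hs.1.le]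
  exact mul_lt_one_of_nonneg_of_lt_one_left hs.1.le hs.2 hz.le

/-- A dilation of a holomorphic function is bounded on the ball. -/
lemma IsHol.exists_norm_dilate_le {f : Cd d → ℂ} (hf : IsHol f) {s : ℝ}
    (hs : s ∈ Ioo (0 : ℝ) 1) : ∃ N : ℕ, ∀ z ∈ unitBall d, ‖UniformSmirnov.dilate s f z‖ ≤ N := by
  obtain ⟨C, hC⟩ := (isCompact_closedBall (0 : Cd d) s).exists_bound_of_continuousOn
    (hf.continuousOn.mono (closedBall_subset_ball hs.2))
  obtain ⟨N, hN⟩ := exists_nat_ge C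
  refine ⟨N, fun z hz => (hC _ ?_).trans hN⟩
  rw [mem_ball_zero_iff] at hz
  rw [mem_closedBall_zero_iff, norm_smul, Complex.norm_real, Real.norm_of_nonneg hs.1.le]
  exact mul_le_of_le_one_right hs.1.le hz.le

lemma exists_rho_dilate_le {f : Cd d → ℂ} (hf : f ∈ NuPlus d) {ε : ℝ≥0∞} (hε : 0 < ε) :
    ∃ s ∈ Ioo (0 : ℝ) 1, rho (dilate s f) f ≤ ε :=
  (((tendsto_order.1 hf.2).2 ε hε).and (Ioo_mem_nhdsLT one_pos)).exists.imp
    fun _ h => ⟨h.2, h.1.le⟩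

/-- `N_u^+` is closed for the metric `ρ`. -/
lemma mem_NuPlus_of_forall_exists_rho_le {h : Cd d → ℂ} (hh : IsHol h)
    (H : ∀ ε : ℝ≥0∞, 0 < ε → ∃ ψ ∈ NuPlus d, rho ψ h ≤ ε) : h ∈ NuPlus d := by
  refine ⟨⟨hh, ?_⟩, ?_⟩
  · obtain ⟨ψ, hψ, hle⟩ := H 1 one_pos
    have := logSize_add_le hψ.1.1 (DifferentiableOn.fun_sub hh hψ.1.1)
    simp only [add_sub_cancel] at this
    refine this.trans_lt (ENNReal.add_lt_top.2 ⟨hψ.1.2, ?_⟩)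
    exact ((rho_comm h ψ).trans_le hle).trans_lt ENNReal.one_lt_top
  · refine ENNReal.tendsto_nhds_zero.2 fun ε hε => ?_
    obtain ⟨ψ, hψ, hle⟩ := H (ε / 3) (ENNReal.div_pos hε.ne' (by simp))
    filter_upwards [ENNReal.tendsto_nhds_zero.1 hψ.2 (ε / 3) (ENNReal.div_pos hε.ne' (by simp)),
      Ioo_mem_nhdsLT (zero_lt_one' ℝ)] with r hr hr1
    have h1 : rho (dilate r h) (dilate r ψ) ≤ ε / 3 :=
      ((logSize_dilate_le (f := fun z => h z - ψ z) hr1).trans_eq (rho_comm h ψ)).trans hle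
    calc rho (dilate r h) h
        ≤ rho (dilate r h) (dilate r ψ) + rho (dilate r ψ) h :=
          rho_triangle (hh.dilate hr1) (hψ.1.1.dilate hr1) hh
      _ ≤ rho (dilate r h) (dilate r ψ) + (rho (dilate r ψ) ψ + rho ψ h) := by
          gcongr
          exact rho_triangle (hψ.1.1.dilate hr1) hψ.1.1 hh
      _ ≤ ε / 3 + (ε / 3 + ε / 3) := by gcongr
      _ = ε := by rw [← add_assoc, ENNReal.add_thirds]

lemma exists_pos_natCast_mul_le {ε : ℝ≥0∞} (hε : 0 < ε) (N : ℕ) :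
    ∃ δ : ℝ≥0∞, 0 < δ ∧ N * δ ≤ ε := by
  refine ⟨ε / (N + 1), ENNReal.div_pos hε.ne' (by finiteness), ?_⟩
  rw [← mul_div_assoc]
  refine ENNReal.div_le_of_le_mul ?_
  rw [mul_comm]
  gcongr
  exact le_self_add

/-- Multiplication by an element of `N_u^+` is continuous at `0`. -/
lemma exists_logSize_mul_le {f : Cd d → ℂ} (hf : f ∈ NuPlus d) {ε : ℝ≥0∞} (hε : 0 < ε) :
    ∃ δ : ℝ≥0∞, 0 < δ ∧ ∀ k : Cd d → ℂ, IsHol k → logSize k ≤ δ →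
      logSize (fun z => f z * k z) ≤ ε := by
  have hε2 : 0 < ε / 2 := ENNReal.half_pos hε.ne'
  -- Split `f` into a dilation bounded by `N` and a ρ-small error. Since `N` depends only on `f` and
  -- `ε`, so does `δ`.
  obtain ⟨s, hs, hsε⟩ := exists_rho_dilate_le hf hε2
  obtain ⟨N, hN⟩ := hf.1.1.exists_norm_dilate_le hs
  obtain ⟨δ, hδ, hδN⟩ := exists_pos_natCast_mul_le hε2 (N + 1)
  refine ⟨δ, hδ, fun k hk hkδ => ?_⟩
  have key := logSize_le_of_le (D := fun z => dilate s f z - f z)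
    (DifferentiableOn.fun_mul hf.1.1 hk) hk
    (DifferentiableOn.fun_sub (hf.1.1.dilate hs) hf.1.1) (N + 1) fun z hz => by
      have h1 := one_add_mul_le_pow (a := ‖k z‖) (by linarith [norm_nonneg (k z)]) N
      have h2 : ‖f z‖ ≤ N + ‖dilate s f z - f z‖ := by
        have := norm_sub_le (dilate s f z) (dilate s f z - f z)
        rw [sub_sub_cancel] at this
        linarith [hN z hz]
      have hk0 := norm_nonneg (k z)
      have hD0 := norm_nonneg (dilate s f z - f z)
      rw [norm_mul]
      calc 1 + ‖f z‖ * ‖k z‖ ≤ 1 + (N + ‖dilate s f z - f z‖) * ‖k z‖ := by gcongr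
        -- The extra factor `1 + ‖k z‖` absorbs the product of `k` with the error; this is why the
        -- exponent is `N + 1`. Bernoulli's inequality handles `1 + N‖k z‖`.
        _ ≤ (1 + N * ‖k z‖) * (1 + ‖k z‖) * (1 + ‖dilate s f z - f z‖) := by
          have : 0 ≤ (N : ℝ) * ‖k z‖ := by positivity
          have h3 : 0 ≤ (N : ℝ) * ‖k z‖ * ‖k z‖ := by positivity
          have h4 : 0 ≤ ‖k z‖ * ‖dilate s f z - f z‖ := by positivity
          have h5 : 0 ≤ (N : ℝ) * ‖k z‖ * ‖dilate s f z - f z‖ := by positivity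
          have h6 : 0 ≤ (N : ℝ) * ‖k z‖ * ‖k z‖ * ‖dilate s f z - f z‖ := by positivity
          nlinarith
        _ ≤ (1 + ‖k z‖) ^ (N + 1) * (1 + ‖dilate s f z - f z‖) := by
          rw [pow_succ]
          gcongr
  calc logSize (fun z => f z * k z)
      ≤ ((N + 1 : ℕ) : ℝ≥0∞) * logSize k + logSize (fun z => dilate s f z - f z) := key
    _ ≤ ((N + 1 : ℕ) : ℝ≥0∞) * δ + ε / 2 := by gcongr; exact hsε
    _ ≤ ε / 2 + ε / 2 := by gcongr
    _ = ε := ENNReal.add_halves ε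

/-! ### Evaluation at the origin -/

lemma sphere_nonempty (hd : 0 < d) : (sphere (0 : Cd d) 1).Nonempty :=
  ⟨EuclideanSpace.single ⟨0, hd⟩ 1, by simp⟩

/-- Evaluation at the origin is controlled by `|||f|||`. -/
lemma log_one_add_norm_le_logSize (hd : 0 < d) {f : Cd d → ℂ} (hf : IsHol f) :
    ENNReal.ofReal (Real.log (1 + ‖f 0‖)) ≤ logSize f := by
  obtain ⟨ζ, hζ⟩ := sphere_nonempty hd
  have hr : (1 / 2 : ℝ) ∈ Ioo (0 : ℝ) 1 := by norm_num
  refine (ENNReal.ofReal_le_ofReal ?_).trans (le_logSize f hζ hr)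
  -- With this rotation `|1 + cf|` equals `1 + |f|` at the centre and is at most `1 + |f|`
  -- elsewhere, so Jensen for `1 + cf` suffices.
  obtain ⟨c, hc, hcf⟩ : ∃ c : ℂ, ‖c‖ = 1 ∧ c * f 0 = ‖f 0‖ := by
    rcases eq_or_ne (f 0) 0 with h0 | h0
    · exact ⟨1, by simp, by simp [h0]⟩
    · refine ⟨‖f 0‖ / f 0, ?_, div_mul_cancel₀ _ h0⟩
      rw [norm_div, Complex.norm_real, norm_norm, div_self (norm_ne_zero_iff.2 h0)]
  have h1 : ‖1 + c * f ((0 : ℂ) • ζ)‖ = 1 + ‖f 0‖ := by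
    rw [zero_smul, hcf, ← Complex.ofReal_one, ← Complex.ofReal_add, Complex.norm_real,
      Real.norm_of_nonneg (by positivity)]
  have hdiff : DifferentiableOn ℂ (fun w : ℂ => 1 + c * f (w • ζ)) (ball 0 1) :=
    ((hf.slice hζ).const_mul c).const_add 1
  have hne : 1 + c * f ((0 : ℂ) • ζ) ≠ 0 := norm_ne_zero_iff.1 (h1 ▸ by positivity)
  have hJ := log_norm_le_circleAverage hr hdiff hne
  rw [h1] at hJ
  refine hJ.trans ?_
  have hI : CircleIntegrable (fun w : ℂ => Real.log ‖1 + c * f (w • ζ)‖) 0 (1 / 2) :=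
    MeromorphicOn.circleIntegrable_log_norm
      ((hdiff.analyticOnNhd isOpen_ball).mono (sphere_abs_subset_ball hr)).meromorphicOn
  refine Real.circleAverage_mono hI (hf.circleIntegrable_log hζ hr) fun w _ => ?_
  have hle : ‖1 + c * f (w • ζ)‖ ≤ 1 + ‖f (w • ζ)‖ := by
    simpa [hc] using norm_add_le (1 : ℂ) (c * f (w • ζ))
  rcases eq_or_ne (1 + c * f (w • ζ)) 0 with h0 | h0
  · rw [h0, norm_zero, Real.log_zero]
    exact Real.log_nonneg (by linarith [norm_nonneg (f (w • ζ))])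
  · exact Real.log_le_log (norm_pos_iff.2 h0) hle

/-- A function that is `ρ`-close to `1` is close to `1` at the origin. -/
lemma exists_rho_one_le_norm_zero (hd : 0 < d) {ε : ℝ} (hε : 0 < ε) :
    ∃ δ : ℝ≥0∞, 0 < δ ∧ ∀ H : Cd d → ℂ, IsHol H → rho H (fun _ => 1) ≤ δ →
      H 0 ≠ 0 ∧ -Real.log ‖H 0‖ ≤ ε := by
  have hη : 0 < 2 - Real.exp (-ε) := by linarith [Real.exp_lt_one_iff.2 (neg_neg_of_pos hε)]
  -- Chosen so that `log(1 + |H(0) - 1|) ≤ δ` means `|H(0) - 1| ≤ 1 - e^{-ε}`, hence `|H(0)| ≥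
  -- e^{-ε}`.
  refine ⟨ENNReal.ofReal (Real.log (2 - Real.exp (-ε))),
    ENNReal.ofReal_pos.2 (Real.log_pos (by linarith [Real.exp_lt_one_iff.2 (neg_neg_of_pos hε)])),
    fun H hH hle => ?_⟩
  have h1 := (log_one_add_norm_le_logSize hd (DifferentiableOn.sub_const hH 1)).trans hle
  rw [ENNReal.ofReal_le_ofReal_iff
    (Real.log_nonneg (by linarith [Real.exp_lt_one_iff.2 (neg_neg_of_pos hε)])),
    Real.log_le_log_iff (by positivity) hη] at h1
  have h2 : Real.exp (-ε) ≤ ‖H 0‖ := by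
    have := norm_sub_norm_le (1 : ℂ) (H 0)
    rw [norm_one, norm_sub_rev] at this
    linarith
  have hpos : 0 < ‖H 0‖ := (Real.exp_pos _).trans_le h2
  refine ⟨norm_pos_iff.1 hpos, ?_⟩
  have := (Real.le_log_iff_exp_le hpos).2 h2
  linarith

end UniformSmirnov
namespace UniformSmirnov

variable {d : ℕ}

/-! ### Cyclicity: absence of zeros and approximation of `1/g` -/

lemma exists_pos_ofReal_le {ε : ℝ≥0∞} (hε : 0 < ε) : ∃ r : ℝ, 0 < r ∧ ENNReal.ofReal r ≤ ε := by
  obtain ⟨r, hr0, hrε⟩ := ENNReal.lt_iff_exists_nnreal_btwn.1 hε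
  exact ⟨r, by exact_mod_cast hr0, by simpa using hrε.le⟩

/-- If `1` is a `ρ`-limit of multiples of `g` by holomorphic functions, then `g` has no zeros. -/
lemma ne_zero_of_forall_exists_rho_mul_le (hd : 0 < d) {g : Cd d → ℂ} (hg : IsHol g)
    (H : ∀ δ : ℝ≥0∞, 0 < δ → ∃ ψ, IsHol ψ ∧ rho (fun z => ψ z * g z) (fun _ => 1) ≤ δ) :
    ∀ z ∈ unitBall d, g z ≠ 0 := by
  intro z hz hgz
  rcases eq_or_ne z 0 with rfl | hz0
  · obtain ⟨δ, hδ, hδH⟩ := exists_rho_one_le_norm_zero hd one_pos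
    obtain ⟨ψ, hψ, hle⟩ := H δ hδ
    exact (hδH _ (DifferentiableOn.fun_mul hψ hg) hle).1 (by rw [hgz, mul_zero])
  have ha : 0 < ‖z‖ := norm_pos_iff.2 hz0
  have ha1 : ‖z‖ < 1 := mem_ball_zero_iff.1 hz
  have hr : (1 + ‖z‖) / 2 ∈ Ioo (0 : ℝ) 1 := ⟨by linarith, by linarith⟩
  set r := (1 + ‖z‖) / 2
  have hza : ‖z‖ < r := by simp only [r]; linarith
  have hζ : ((‖z‖ : ℂ)⁻¹ • z) ∈ sphere (0 : Cd d) 1 := by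
    rw [mem_sphere_zero_iff_norm, norm_smul, norm_inv, Complex.norm_real, norm_norm,
      inv_mul_cancel₀ ha.ne']
  have haC : (‖z‖ : ℂ) ≠ 0 := by exact_mod_cast ha.ne'
  have hL : 0 < Real.log (r / ‖z‖) := Real.log_pos ((one_lt_div ha).2 hza)
  -- Let `L = log(r/‖z‖)`. On the slice through `z`, Jensen with the zero at `w = ‖z‖` gives a mean
  -- of `log|ψg|` at least `-L/3 + L`, while closeness to `1` bounds it by `L/3`.
  obtain ⟨δ, hδ, hδH⟩ := exists_rho_one_le_norm_zero hd (ε := Real.log (r / ‖z‖) / 3) (by linarith)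
  obtain ⟨ψ, hψ, hle⟩ := H (min δ (ENNReal.ofReal (Real.log (r / ‖z‖) / 3)))
    (lt_min hδ (ENNReal.ofReal_pos.2 (by linarith)))
  have hG : IsHol (fun z => ψ z * g z) := DifferentiableOn.fun_mul hψ hg
  obtain ⟨h0, hlog⟩ := hδH _ hG (hle.trans (min_le_left _ _))
  have hs := hG.slice hζ
  have hJ := log_norm_add_log_le_circleAverage hr hs (by simpa using h0) (a := (‖z‖ : ℂ))
    (by simpa using hza.le) (by simp [smul_smul, mul_inv_cancel₀ haC, hgz])
  have hI : CircleIntegrable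
      (fun w : ℂ => Real.log ‖ψ (w • (‖z‖ : ℂ)⁻¹ • z) * g (w • (‖z‖ : ℂ)⁻¹ • z)‖) 0 r :=
    MeromorphicOn.circleIntegrable_log_norm
      ((hs.analyticOnNhd isOpen_ball).mono (sphere_abs_subset_ball hr)).meromorphicOn
  have hH1 : IsHol (fun z => ψ z * g z - 1) := DifferentiableOn.sub_const hG 1
  have hmono := Real.circleAverage_mono hI (hH1.circleIntegrable_log hζ hr) fun w _ => by
    set u := ψ (w • (‖z‖ : ℂ)⁻¹ • z) * g (w • (‖z‖ : ℂ)⁻¹ • z)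
    rcases eq_or_ne u 0 with h | h
    · rw [h, norm_zero, Real.log_zero]
      exact Real.log_nonneg (by linarith [norm_nonneg ((0 : ℂ) - 1)])
    · refine Real.log_le_log (norm_pos_iff.2 h) ?_
      simpa using norm_add_le (1 : ℂ) (u - 1)
  have hub := (le_logSize (fun z => ψ z * g z - 1) hζ hr).trans (hle.trans (min_le_right _ _))
  rw [ENNReal.ofReal_le_ofReal_iff (by linarith)] at hub
  simp only [zero_smul, Complex.norm_real, norm_norm] at hJ
  linarith

/-- If multiples `ψ g` with `ψ ∈ S ⊆ N_u^+` approximate `1`, then elements of `S` approximate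
`1 / g`. -/
lemma exists_rho_inv_le (hd : 0 < d) {g : Cd d → ℂ} (hg : IsHol g)
    (hg0 : ∀ z ∈ unitBall d, g z ≠ 0) {S : Set (Cd d → ℂ)} (hS : S ⊆ NuPlus d)
    (H : ∀ δ : ℝ≥0∞, 0 < δ → ∃ ψ ∈ S, rho (fun z => ψ z * g z) (fun _ => 1) ≤ δ)
    {ε : ℝ≥0∞} (hε : 0 < ε) : ∃ ψ ∈ S, rho ψ (fun z => (g z)⁻¹) ≤ ε := by
  have hε4 : 0 < ε / 4 := ENNReal.div_pos hε.ne' (by simp)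
  obtain ⟨η, hη, hηε⟩ := exists_pos_ofReal_le hε4
  obtain ⟨δ₁, hδ₁, hδH⟩ := exists_rho_one_le_norm_zero hd hη
  -- The order of choices matters: `φ` is fixed first, its dilation determines `N`, and only then is
  -- `ψg` taken within a `δ` depending on `N`.
  obtain ⟨φ, hφS, hφ⟩ := H (min δ₁ (ε / 4)) (lt_min hδ₁ hε4)
  have hφh : IsHol φ := (hS hφS).1.1
  have hφg : IsHol (fun z => φ z * g z) := DifferentiableOn.fun_mul hφh hg
  obtain ⟨hφ0, hφlog⟩ := hδH _ hφg (hφ.trans (min_le_left _ _))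
  obtain ⟨s, hs, hsε⟩ := exists_rho_dilate_le (hS hφS) hε4
  obtain ⟨N, hN⟩ := hφh.exists_norm_dilate_le hs
  obtain ⟨δ, hδ, hδN⟩ := exists_pos_natCast_mul_le hε4 (N + 1)
  obtain ⟨ψ, hψS, hψ⟩ := H δ hδ
  have hψh : IsHol ψ := (hS hψS).1.1
  refine ⟨ψ, hψS, ?_⟩
  have key := logSize_le_of_le_div (f := fun z => ψ z - (g z)⁻¹) (k := fun z => ψ z * g z - 1)
    (D := fun z => dilate s φ z - φ z) (H := fun z => φ z * g z)
    (DifferentiableOn.fun_sub hψh (DifferentiableOn.fun_inv hg hg0))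
    (DifferentiableOn.sub_const (DifferentiableOn.fun_mul hψh hg) 1)
    (DifferentiableOn.fun_sub (hφh.dilate hs) hφh) hφg (N + 1) hφ0 fun z hz hHz => by
      have hgz := hg0 z hz
      have hgn := norm_pos_iff.2 hgz
      have hφn := norm_pos_iff.2 (left_ne_zero_of_mul hHz)
      have hf : ‖ψ z - (g z)⁻¹‖ = ‖ψ z * g z - 1‖ / ‖g z‖ := by
        rw [← norm_div, sub_div, mul_div_cancel_right₀ _ hgz, one_div]
      have h1 := one_add_mul_le_pow (a := ‖ψ z * g z - 1‖)
        (by linarith [norm_nonneg (ψ z * g z - 1)]) (N + 1)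
      -- With `N` in place of `N + 1` the bound can fail when `N = 0`.
      have h2 : ‖φ z‖ ≤ ((N + 1 : ℕ) : ℝ) * (1 + ‖dilate s φ z - φ z‖) := by
        have := norm_sub_le (dilate s φ z) (dilate s φ z - φ z)
        rw [sub_sub_cancel] at this
        push_cast
        nlinarith [hN z hz, mul_nonneg (Nat.cast_nonneg (α := ℝ) N)
          (norm_nonneg (dilate s φ z - φ z))]
      have h3 : ‖φ z‖ * ‖g z‖ ≤ 1 + ‖φ z * g z - 1‖ := by
        rw [← norm_mul]
        simpa using norm_add_le (1 : ℂ) (φ z * g z - 1)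
      have hk0 := norm_nonneg (ψ z * g z - 1)
      have hD0 := norm_nonneg (dilate s φ z - φ z)
      have he0 := norm_nonneg (φ z * g z - 1)
      have hM0 : (0 : ℝ) ≤ ((N + 1 : ℕ) : ℝ) := Nat.cast_nonneg _
      rw [hf, norm_mul]
      generalize ((N + 1 : ℕ) : ℝ) = M at *
      generalize ‖ψ z * g z - 1‖ = k at *
      generalize ‖dilate s φ z - φ z‖ = D at *
      generalize ‖φ z * g z - 1‖ = e at *
      rw [le_div_iff₀ (mul_pos hφn hgn)]
      calc (1 + k / ‖g z‖) * (‖φ z‖ * ‖g z‖) = ‖φ z‖ * ‖g z‖ + k * ‖φ z‖ := by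
            field_simp
        _ ≤ (1 + e) + k * (M * (1 + D)) := by gcongr
        _ ≤ (1 + D) * (1 + e) + k * (M * (1 + D)) * (1 + e) := by
          have : 0 ≤ k * (M * (1 + D)) := by positivity
          nlinarith [mul_nonneg hD0 he0, mul_nonneg this he0]
        _ = (1 + M * k) * (1 + D) * (1 + e) := by ring
        _ ≤ _ := by gcongr
  calc rho ψ (fun z => (g z)⁻¹)
      ≤ ((N + 1 : ℕ) : ℝ≥0∞) * logSize (fun z => ψ z * g z - 1)
        + logSize (fun z => dilate s φ z - φ z) + logSize (fun z => φ z * g z - 1)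
        + ENNReal.ofReal (-Real.log ‖φ 0 * g 0‖) := key
    _ ≤ ε / 4 + ε / 4 + ε / 4 + ε / 4 := by
        gcongr
        · exact (mul_le_mul_right hψ _).trans (by exact_mod_cast hδN)
        · exact hsε
        · exact hφ.trans (min_le_right _ _)
        · exact (ENNReal.ofReal_le_ofReal hφlog).trans hηε
    _ = ε := by
        rw [show ε / 4 + ε / 4 + ε / 4 + ε / 4 = 4 * (ε / 4) by ring]
        exact ENNReal.mul_div_cancel (by simp) (by simp)

section Spaces

variable {X : Type*} [NormedAddCommGroup X] [NormedSpace ℂ X] {J : X →ₗ[ℂ] (Cd d → ℂ)}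

/-- For cyclic `g`, multiples `ψ g` with `ψ` a multiplier in `X` approximate `1`. -/
lemma IsCyclicElem.exists_rho_mul_le (hconst : ∀ c : ℂ, MemSpace J (fun _ => c))
    (hcont : ContinuouslyContained J) {g : X} (hg : IsCyclicElem J g) {δ : ℝ≥0∞} (hδ : 0 < δ) :
    ∃ ψ ∈ {ψ | (∃ y, J y = ψ) ∧ IsMult J ψ}, rho (fun z => ψ z * J g z) (fun _ => 1) ≤ δ := by
  obtain ⟨e, he⟩ := hconst 1
  obtain ⟨x, hle, φ, hφ, hx⟩ :=
    mem_closure_iff_nhds.1 (hg e) _ (ENNReal.tendsto_nhds_zero.1 (hcont.2 e) δ hδ)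
  -- Applying `φ` to the constant `1` shows that `φ` itself lies in `X`, hence in `N_u^+`.
  obtain ⟨y, hy⟩ := hφ e
  have hyφ : EqOn (J y) φ (unitBall d) := fun z hz => by
    simpa [he hz] using hy hz
  refine ⟨J y, ⟨⟨y, rfl⟩, fun u => ?_⟩, (rho_congr (fun z hz => ?_) he.symm).trans_le hle⟩
  · obtain ⟨v, hv⟩ := hφ u
    exact ⟨v, fun z hz => by simp only [hv hz, hyφ hz]⟩
  · simp only [hx hz, hyφ hz]

end Spaces

end UniformSmirnov

/-! ### The theorem -/

open UniformSmirnov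

theorem theorem3p7 (d : ℕ) (hd : 0 < d)
    {X : Type*} [NormedAddCommGroup X] [NormedSpace ℂ X] [CompleteSpace X]
    (J : X →ₗ[ℂ] (UniformSmirnov.Cd d → ℂ))
    (hJ : UniformSmirnov.IsHolSpace J)
    (hconst : ∀ c : ℂ, UniformSmirnov.MemSpace J (fun _ => c))
    (hmult : UniformSmirnov.MultDense J)
    (hcont : UniformSmirnov.ContinuouslyContained J)
    (g : X) (hg : UniformSmirnov.IsCyclicElem J g) :
    (∀ z ∈ UniformSmirnov.unitBall d, J g z ≠ 0) ∧
      UniformSmirnov.ContinuouslyContained (UniformSmirnov.invSpace (J g) J) := by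
  set S : Set (Cd d → ℂ) := {ψ | (∃ y, J y = ψ) ∧ IsMult J ψ} with hS
  have hSN : S ⊆ NuPlus d := by
    rintro _ ⟨⟨y, rfl⟩, -⟩
    exact hcont.1 y
  have happrox := fun (δ : ℝ≥0∞) (hδ : 0 < δ) => hg.exists_rho_mul_le hconst hcont hδ
  have hg0 : ∀ z ∈ unitBall d, J g z ≠ 0 :=
    ne_zero_of_forall_exists_rho_mul_le hd (hJ.hol g) fun δ hδ =>
      (happrox δ hδ).imp fun ψ h => ⟨(hSN h.1).1.1, h.2⟩
  have hinvh : IsHol fun z => (J g z)⁻¹ := DifferentiableOn.fun_inv (hJ.hol g) hg0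
  have hinv := fun (ε : ℝ≥0∞) (hε : 0 < ε) =>
    exists_rho_inv_le hd (hJ.hol g) hg0 hSN happrox hε
  have hinvN : (fun z => (J g z)⁻¹) ∈ NuPlus d :=
    mem_NuPlus_of_forall_exists_rho_le hinvh fun ε hε =>
      (hinv ε hε).imp fun ψ h => ⟨hSN h.1, h.2⟩
  refine ⟨hg0, fun x => ?_, fun x => ?_⟩
  · have hquot : IsHol (invSpace (J g) J x) :=
      (DifferentiableOn.fun_mul (hJ.hol x) hinvh).congr fun z _ => div_eq_mul_inv _ _
    refine mem_NuPlus_of_forall_exists_rho_le hquot fun ε hε => ?_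
    obtain ⟨δ, hδ, hδx⟩ := exists_logSize_mul_le (hcont.1 x) hε
    obtain ⟨ψ, ⟨⟨y, hy⟩, hψ⟩, hle⟩ := hinv δ hδ
    -- Since `ψ` is a multiplier, `ψf` is in `X`, and `ψf - f/g = f(ψ - 1/g)` is ρ-small.
    obtain ⟨u, hu⟩ := hψ x
    refine ⟨J u, hcont.1 u, (logSize_congr fun z hz => ?_).trans_le
      (hδx _ (DifferentiableOn.fun_sub (hy ▸ hJ.hol y) hinvh) hle)⟩
    change J u z - J x z / J g z = J x z * (ψ z - (J g z)⁻¹)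
    rw [hu hz, div_eq_mul_inv]
    ring
  · refine ENNReal.tendsto_nhds_zero.2 fun ε hε => ?_
    obtain ⟨δ, hδ, hδg⟩ := exists_logSize_mul_le hinvN hε
    filter_upwards [ENNReal.tendsto_nhds_zero.1 (hcont.2 x) δ hδ] with y hy
    refine (logSize_congr fun z _ => ?_).trans_le
      (hδg _ (DifferentiableOn.fun_sub (hJ.hol y) (hJ.hol x)) hy)
    change J y z / J g z - J x z / J g z = (J g z)⁻¹ * (J y z - J x z)
    rw [div_eq_mul_inv, div_eq_mul_inv]
    ring
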